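/- Let $M\ge 0$ be an integer and let $P_0,\bar P,\tau,R_0>0$. Let $h_0,h_1,\dots,h_M$ be independent complex Rayleigh fading coefficients with common unit mean power: all amplitudes $|h_m|$ have the density $2re^{-r^2}$ on $r\ge 0$, so that the channel gains $|h_m|^2$ are $\mathrm{Exp}(1)$-distributed. The grant-based user $\mathrm U_0$ has channel $h_0$ and transmit power $P_0$. The grant-free users $\mathrm U_1,\dots,\mathrm U_M$ have channels $h_1,\dots,h_M$ and common transmit power $\bar P$, and $\mathrm U_m$ ($1\le m\le M$) is admitted if and only if $|h_m|^2<\tau$. The noise power is $1$, and the signal of $\mathrm U_0$ is decoded first in successive interference cancellation, so that the rate supported for $\mathrm U_0$ is $$\log_2\left(1+\frac{|h_0|^2P_0}{\bar P\sum_{1\le m\le M,\ |h_m|^2<\tau}|h_m|^2+1}\right).$$ Let $\mathbb P_0^{\mathrm{I,OL}}$ be the outage probability of $\mathrm U_0$, that is, the probability that this rate is smaller than the target rate $R_0$. Then, with $\epsilon_0=2^{R_0}-1$, $$\mathbb P_0^{\mathrm{I,OL}}=\sum_{n=1}^{M}\frac{M!}{n!(M-n)!}e^{-(M-n)\tau}\left(1-e^{-\tau}\right)^n\sum_{p=0}^{n}\frac{\binom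 np(-1)^pe^{-p\tau}}{(1-e^{-\tau})^n}\left(\sum_{l=0}^{n-1}\frac{\epsilon_0P_0^{-1}\bar P\,e^{-\epsilon_0P_0^{-1}(1+\bar Pp\tau)}}{(1+\epsilon_0P_0^{-1}\bar P)^{l+1}}+e^{-\epsilon_0P_0^{-1}}-e^{-\epsilon_0P_0^{-1}(1+\bar Pp\tau)}\right)+\left(1-e^{-\epsilon_0P_0^{-1}}\right).$$ -/

import Mathlib

open MeasureTheory ProbabilityTheory

noncomputable section

/-- The Rayleigh law on `ℝ` with unit mean square: density `2 r exp (-r ^ 2)` on `r ≥ 0`. -/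
def rayleighMeasure : Measure ℝ :=
  volume.withDensity
    (fun r => ENNReal.ofReal (if 0 ≤ r then 2 * r * Real.exp (-r ^ 2) else 0))

/-- The channel coefficients `h 0, …, h M` of the users `U₀, …, U_M` undergo independent
Rayleigh fading with a common (unit) mean power: the `h m` are independent complex random
variables whose amplitudes `|h m|` all have the unit Rayleigh law. The index `0` is the
grant-based user, the indices `m.succ` are the grant-free users. -/
structure IsRayleighFading {Ω : Type*} [MeasurableSpace Ω] (P : Measure Ω) {M : ℕ}
    (h : Fin (M + 1) → Ω → ℂ) : Prop where
  measurable : ∀ m, Measurable (h m)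
  indep : iIndepFun h P
  law : ∀ m, P.map (fun ω => ‖h m ω‖) = rayleighMeasure

/-- The grant-free users (`m : Fin M` stands for `U_{m+1}`) that are admitted when the
threshold `τ` is broadcast: those whose channel gain `|h|²` is below `τ`. -/
def admittedUsers {M : ℕ} (τ : ℝ) (c : Fin (M + 1) → ℂ) : Finset (Fin M) :=
  Finset.univ.filter (fun m => ‖c m.succ‖ ^ 2 < τ)

/-- The data rate (in bits per channel use, unit noise power) supported for `U₀` when its signal
is decoded first, that is, treating the signals of all admitted grant-free users as noise.
`P₀` is the power of `U₀`, `Pbar` that of each grant-free user, `c` the channel realization. -/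
def rateU0 {M : ℕ} (P₀ Pbar τ : ℝ) (c : Fin (M + 1) → ℂ) : ℝ :=
  Real.logb 2
    (1 + ‖c 0‖ ^ 2 * P₀ / ((∑ m ∈ admittedUsers τ c, ‖c m.succ‖ ^ 2 * Pbar) + 1))

/-- The outage probability of `U₀`: the probability that the supported rate is below the
target rate `R₀`. -/
def outageProbabilityU0 {Ω : Type*} [MeasurableSpace Ω] (P : Measure Ω) {M : ℕ}
    (h : Fin (M + 1) → Ω → ℂ) (P₀ Pbar τ R₀ : ℝ) : ℝ :=
  P.real {ω | rateU0 P₀ Pbar τ (fun m => h m ω) < R₀}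

end

/-! With `a = ε₀ * P₀⁻¹` and `b = a * Pbar`, outage means `‖h 0‖² < a * (1 + Pbar * S)`, where `S`
sums the gains truncated at `τ`. Since `‖h 0‖²` is exponential and independent of `S`, the outage
probability is `1 - E exp(-a * (1 + Pbar * S))`. Independence factors this as `1 - e^{-a} (K +
e^{-τ})^M` with `K = (1 - e^{-(1+b)τ}) / (1 + b)` (`outageProbabilityU0_eq_one_sub`), so no
conditioning on the number of admitted users is needed. The stated formula is the binomial expansion
of this: the sums over `l` and `p` collapse to `e^{-a} ((1 - e^{-τ})^n - K^n)`
(`alternating_sum_eq`), and the sum over `n` then gives `e^{-a} (1 - (K + e^{-τ})^M)`. -/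

/-- The Laplace-type transform of the squared amplitude, truncated to amplitudes below `s`. -/
theorem setIntegral_Iio_exp_neg_mul_sq_rayleighMeasure {b s : ℝ} (hb : 0 ≤ b) (hs : 0 ≤ s) :
    ∫ r in Set.Iio s, Real.exp (-b * r ^ 2) ∂rayleighMeasure =
      (1 - Real.exp (-(1 + b) * s ^ 2)) / (1 + b) := by
  have hb1 : (1 + b) ≠ 0 := by positivity
  have hmeas : Measurable fun r : ℝ =>
      ENNReal.ofReal (if 0 ≤ r then 2 * r * Real.exp (-r ^ 2) else 0) :=
    (Measurable.ite measurableSet_Ici (by fun_prop) measurable_const).ennreal_ofReal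
  have hderiv (r : ℝ) : HasDerivAt (fun r => -Real.exp (-(1 + b) * r ^ 2) / (1 + b))
      (2 * r * Real.exp (-(1 + b) * r ^ 2)) r := by
    have := (((hasDerivAt_pow 2 r).const_mul (-(1 + b))).exp.neg).div_const (1 + b)
    refine this.congr_deriv ?_
    rw [div_eq_iff hb1]
    push_cast
    ring
  rw [rayleighMeasure, setIntegral_withDensity_eq_setIntegral_toReal_smul hmeas
      (Filter.Eventually.of_forall fun _ => ENNReal.ofReal_lt_top) _ measurableSet_Iio,
    setIntegral_eq_of_subset_of_forall_sdiff_eq_zero (s := Set.Ico 0 s) measurableSet_Iio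
      (fun x hx => hx.2) ?_]
  · rw [setIntegral_congr_fun (g := fun r => 2 * r * Real.exp (-(1 + b) * r ^ 2))
      measurableSet_Ico, integral_Ico_eq_integral_Ioc, ← intervalIntegral.integral_of_le hs,
      intervalIntegral.integral_eq_sub_of_hasDerivAt (fun r _ => hderiv r)
        (Continuous.intervalIntegrable (by fun_prop) _ _)]
    · simp
      ring
    · intro r hr
      have h0 : 0 ≤ r := hr.1
      have h1 : 0 ≤ 2 * r * Real.exp (-r ^ 2) := by positivity
      simp only [h0, if_true, ENNReal.toReal_ofReal h1, smul_eq_mul]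
      rw [mul_assoc, ← Real.exp_add]
      ring_nf
  · intro x hx
    have : ¬ 0 ≤ x := fun h0 => hx.2 ⟨h0, hx.1⟩
    simp [this]

theorem rayleighMeasure_real_Iio {s : ℝ} (hs : 0 ≤ s) :
    rayleighMeasure.real (Set.Iio s) = 1 - Real.exp (-s ^ 2) := by
  simpa using setIntegral_Iio_exp_neg_mul_sq_rayleighMeasure le_rfl hs

/-- One user's factor in the transform of `S`: beyond `s` the integrand is `1`, so a rejected user
contributes only its tail mass. -/
theorem integral_exp_neg_mul_truncated_sq_rayleighMeasure [IsProbabilityMeasure rayleighMeasure]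
    {b s : ℝ} (hb : 0 ≤ b) (hs : 0 ≤ s) :
    ∫ r, Real.exp (-b * if r < s then r ^ 2 else 0) ∂rayleighMeasure =
      (1 - Real.exp (-(1 + b) * s ^ 2)) / (1 + b) + Real.exp (-s ^ 2) := by
  have hmeas : Measurable fun r : ℝ => Real.exp (-b * if r < s then r ^ 2 else 0) :=
    ((Measurable.ite measurableSet_Iio (by fun_prop) measurable_const).const_mul _).exp
  have hint : Integrable (fun r : ℝ => Real.exp (-b * if r < s then r ^ 2 else 0))
      rayleighMeasure := by
    refine Integrable.of_bound hmeas.aestronglyMeasurable 1 (.of_forall fun r => ?_)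
    rw [Real.norm_eq_abs, Real.abs_exp, Real.exp_le_one_iff]
    split_ifs
    · nlinarith [mul_nonneg hb (sq_nonneg r)]
    · simp
  rw [← integral_add_compl measurableSet_Iio (s := Set.Iio s) hint,
    setIntegral_congr_fun (g := fun r => Real.exp (-b * r ^ 2)) measurableSet_Iio,
    setIntegral_Iio_exp_neg_mul_sq_rayleighMeasure hb hs,
    setIntegral_congr_fun (g := fun _ => (1 : ℝ)) measurableSet_Iio.compl]
  · rw [setIntegral_const, probReal_compl_eq_one_sub measurableSet_Iio,
      rayleighMeasure_real_Iio hs]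
    simp
  · intro r hr
    have : ¬ r < s := hr
    simp [this]
  · intro r hr
    have : r < s := hr
    simp [this]

/-- The probability that a Rayleigh amplitude is below an independent random threshold. -/
theorem measureReal_lt_of_indepFun_rayleigh {Ω : Type*} [MeasurableSpace Ω] {P : Measure Ω}
    [IsProbabilityMeasure P] {X T : Ω → ℝ} (hX : Measurable X) (hT : Measurable T)
    (hXT : IndepFun X T P) (hlaw : P.map X = rayleighMeasure) (hT0 : ∀ ω, 0 ≤ T ω) :
    P.real {ω | X ω < T ω} = ∫ ω, (1 - Real.exp (-T ω ^ 2)) ∂P := by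
  have : IsProbabilityMeasure rayleighMeasure :=
    hlaw ▸ Measure.isProbabilityMeasure_map hX.aemeasurable
  have : IsProbabilityMeasure (P.map T) := Measure.isProbabilityMeasure_map hT.aemeasurable
  have hset : MeasurableSet {p : ℝ × ℝ | p.1 < p.2} :=
    measurableSet_lt measurable_fst measurable_snd
  have hmeasure : P {ω | X ω < T ω} = ∫⁻ ω, rayleighMeasure (Set.Iio (T ω)) ∂P := by
    have hmap := (indepFun_iff_map_prod_eq_prod_map_map hX.aemeasurable hT.aemeasurable).1 hXT
    have happ := Measure.map_apply (μ := P) (hX.prodMk hT) hset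
    rw [hmap, hlaw, Measure.prod_apply_symm hset,
      lintegral_map (measurable_measure_prodMk_right hset) hT] at happ
    exact happ.symm
  have hreal (ω : Ω) : rayleighMeasure (Set.Iio (T ω)) =
      ENNReal.ofReal (1 - Real.exp (-T ω ^ 2)) := by
    rw [← rayleighMeasure_real_Iio (hT0 ω), ofReal_measureReal]
  rw [measureReal_def, hmeasure, lintegral_congr hreal, integral_eq_lintegral_of_nonneg_ae]
  · exact .of_forall fun ω => sub_nonneg.2 (Real.exp_le_one_iff.2 (by nlinarith [sq_nonneg (T ω)]))
  · exact Measurable.aestronglyMeasurable (by fun_prop)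

/-- Moving admission into the summand replaces a sum over a random set by a fixed sum of functions
of the individual channels, to which independence applies. -/
theorem rateU0_lt_iff {M : ℕ} {P₀ Pbar τ R₀ ε₀ : ℝ} (hP₀ : 0 < P₀) (hPbar : 0 < Pbar)
    (hε₀ : ε₀ = (2 : ℝ) ^ R₀ - 1) (c : Fin (M + 1) → ℂ) :
    rateU0 P₀ Pbar τ c < R₀ ↔
      ‖c 0‖ < √(ε₀ * P₀⁻¹ * (1 + Pbar *
        ∑ m : Fin M, if ‖c m.succ‖ < √τ then ‖c m.succ‖ ^ 2 else 0)) := by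
  have hsum : ∑ m ∈ admittedUsers τ c, ‖c m.succ‖ ^ 2 * Pbar =
      Pbar * ∑ m : Fin M, if ‖c m.succ‖ < √τ then ‖c m.succ‖ ^ 2 else 0 := by
    simp_rw [admittedUsers, Real.lt_sqrt (norm_nonneg _)]
    rw [← Finset.sum_filter, ← Finset.sum_mul, mul_comm]
  have hS : 0 ≤ ∑ m : Fin M, if ‖c m.succ‖ < √τ then ‖c m.succ‖ ^ 2 else 0 :=
    Finset.sum_nonneg fun m _ => by positivity
  rw [rateU0, hsum]
  set S := ∑ m : Fin M, if ‖c m.succ‖ < √τ then ‖c m.succ‖ ^ 2 else 0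
  have hD : 0 < Pbar * S + 1 := by positivity
  rw [Real.logb_lt_iff_lt_rpow one_lt_two (by positivity), ← lt_sub_iff_add_lt', ← hε₀,
    Real.lt_sqrt (norm_nonneg _), div_lt_iff₀ hD, ← lt_div_iff₀ hP₀]
  congr! 1
  field_simp
  ring

/-- The outage probability in closed product form. -/
theorem outageProbabilityU0_eq_one_sub {Ω : Type*} [MeasurableSpace Ω] (P : Measure Ω)
    [IsProbabilityMeasure P] {M : ℕ} {h : Fin (M + 1) → Ω → ℂ} (hfading : IsRayleighFading P h)
    {P₀ Pbar τ R₀ ε₀ : ℝ} (hP₀ : 0 < P₀) (hPbar : 0 < Pbar) (hτ : 0 < τ) (hε : 0 ≤ ε₀)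
    (hε₀ : ε₀ = (2 : ℝ) ^ R₀ - 1) :
    outageProbabilityU0 P h P₀ Pbar τ R₀ =
      1 - Real.exp (-ε₀ * P₀⁻¹) *
        ((1 - Real.exp (-(1 + ε₀ * P₀⁻¹ * Pbar) * τ)) / (1 + ε₀ * P₀⁻¹ * Pbar) +
          Real.exp (-τ)) ^ M := by
  have hnorm (m : Fin (M + 1)) : Measurable fun ω => ‖h m ω‖ := (hfading.measurable m).norm
  have : IsProbabilityMeasure rayleighMeasure :=
    hfading.law 0 ▸ Measure.isProbabilityMeasure_map (hnorm 0).aemeasurable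
  set a := ε₀ * P₀⁻¹ with ha
  have ha0 : 0 ≤ a := by positivity
  let g : ℝ → ℝ := fun r => if r < √τ then r ^ 2 else 0
  have hg : Measurable g := Measurable.ite measurableSet_Iio (by fun_prop) measurable_const
  have hg0 (r : ℝ) : 0 ≤ g r := by simp only [g]; positivity
  have hgh (m : Fin (M + 1)) : Measurable fun ω => g ‖h m ω‖ := hg.comp (hnorm m)
  let S : Ω → ℝ := fun ω => ∑ m : Fin M, g ‖h m.succ ω‖
  have hS : Measurable S := Finset.measurable_sum _ fun m _ => hgh m.succ
  have hS0 (ω : Ω) : 0 ≤ S ω := Finset.sum_nonneg fun m _ => hg0 _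
  have hindep : IndepFun (fun ω => ‖h 0 ω‖) S P := by
    -- A single index-dependent family holds both the amplitude at `0` and the truncated gains
    -- elsewhere, so that the independence of one member from a sum of others applies.
    have hcomp := hfading.indep.comp (fun i c => if i = 0 then ‖c‖ else g ‖c‖) (fun i => by
      split_ifs
      · exact measurable_norm
      · exact hg.comp measurable_norm)
    have := (hcomp.indepFun_finsetSum_of_notMem
      (fun i => by
        dsimp only [Function.comp_def]
        split_ifs
        · exact hnorm i
        · exact hgh i)
      (s := Finset.univ.image Fin.succ) (i := 0) (by simp)).symm
    rw [Finset.sum_image (fun _ _ _ _ e => Fin.succ_injective _ e)] at this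
    convert this using 1
    · ext ω
      simp
    · ext ω
      simp [S, Fin.succ_ne_zero]
  let T : Ω → ℝ := fun ω => √(a * (1 + Pbar * S ω))
  have hT : Measurable T := by fun_prop
  have hT2 (ω : Ω) : T ω ^ 2 = a * (1 + Pbar * S ω) :=
    Real.sq_sqrt (by have := hS0 ω; positivity)
  have hout : outageProbabilityU0 P h P₀ Pbar τ R₀ = P.real {ω | ‖h 0 ω‖ < T ω} := by
    simp only [outageProbabilityU0, rateU0_lt_iff hP₀ hPbar hε₀]
    rfl
  have hindepT : IndepFun (fun ω => ‖h 0 ω‖) T P :=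
    hindep.comp (φ := id) (ψ := fun x => √(a * (1 + Pbar * x))) measurable_id (by fun_prop)
  have hexp (ω : Ω) : Real.exp (-T ω ^ 2) =
      Real.exp (-a) * ∏ m : Fin M, Real.exp (-(a * Pbar) * g ‖h m.succ ω‖) := by
    rw [hT2, ← Real.exp_sum, ← Finset.mul_sum, ← Real.exp_add]
    congr 1
    simp only [S]
    ring
  have hfactor (m : Fin M) : ∫ ω, Real.exp (-(a * Pbar) * g ‖h m.succ ω‖) ∂P =
      (1 - Real.exp (-(1 + a * Pbar) * τ)) / (1 + a * Pbar) + Real.exp (-τ) := by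
    have hmap := integral_map (μ := P) (hnorm m.succ).aemeasurable
      (f := fun r => Real.exp (-(a * Pbar) * g r))
      (Measurable.aestronglyMeasurable (by fun_prop))
    rw [← hmap, hfading.law]
    have := integral_exp_neg_mul_truncated_sq_rayleighMeasure (b := a * Pbar) (by positivity)
      (Real.sqrt_nonneg τ)
    rwa [Real.sq_sqrt hτ.le] at this
  have hprod : ∫ ω, ∏ m : Fin M, Real.exp (-(a * Pbar) * g ‖h m.succ ω‖) ∂P =
      ((1 - Real.exp (-(1 + a * Pbar) * τ)) / (1 + a * Pbar) + Real.exp (-τ)) ^ M := by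
    have hsucc : iIndepFun (fun m : Fin M => h m.succ) P :=
      hfading.indep.precomp (Fin.succ_injective M)
    rw [hsucc.integral_fun_prod_comp (f := fun _ c => Real.exp (-(a * Pbar) * g ‖c‖))
      (fun m => (hfading.measurable _).aemeasurable)
      (fun m => Measurable.aestronglyMeasurable (by fun_prop))]
    rw [Finset.prod_congr rfl fun m _ => hfactor m, Finset.prod_const, Finset.card_univ,
      Fintype.card_fin]
  have hint : Integrable (fun ω => Real.exp (-T ω ^ 2)) P := by
    refine Integrable.of_bound (Measurable.aestronglyMeasurable (by fun_prop)) 1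
      (.of_forall fun ω => ?_)
    rw [Real.norm_eq_abs, Real.abs_exp, Real.exp_le_one_iff]
    nlinarith [sq_nonneg (T ω)]
  rw [hout, measureReal_lt_of_indepFun_rayleigh (hnorm 0) hT hindepT (hfading.law 0)
    (fun ω => Real.sqrt_nonneg _), integral_sub (integrable_const _) hint]
  simp_rw [hexp]
  rw [integral_const_mul, hprod]
  simp [ha]

/-- A geometric sum of ratio `1 / (1 + b)`. -/
theorem sum_range_div_one_add_pow {b : ℝ} (hb : 0 < b) (x : ℝ) (n : ℕ) :
    ∑ l ∈ Finset.range n, b * x / (1 + b) ^ (l + 1) = x * (1 - ((1 + b) ^ n)⁻¹) := by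
  have : 1 + b ≠ 0 := by positivity
  induction n with
  | zero => simp
  | succ n ih =>
    rw [Finset.sum_range_succ, ih]
    field_simp
    ring

theorem sum_choose_mul_neg_one_pow_mul_exp (n : ℕ) (y : ℝ) :
    ∑ p ∈ Finset.range (n + 1), (n.choose p : ℝ) * (-1) ^ p * Real.exp (-(p : ℝ) * y) =
      (1 - Real.exp (-y)) ^ n := by
  rw [sub_eq_neg_add, add_pow]
  refine Finset.sum_congr rfl fun p _ => ?_
  rw [neg_pow (Real.exp (-y)), ← Real.exp_nat_mul]
  ring_nf

/-- The alternating sum over `p` in the outage formula. -/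
theorem alternating_sum_eq {a b τ : ℝ} (hb : 0 < b) (n : ℕ) :
    ∑ p ∈ Finset.range (n + 1), (n.choose p : ℝ) * (-1) ^ p * Real.exp (-(p : ℝ) * τ) *
        ((∑ l ∈ Finset.range n, b * Real.exp (-a - b * (p : ℝ) * τ) / (1 + b) ^ (l + 1))
          + Real.exp (-a) - Real.exp (-a - b * (p : ℝ) * τ)) =
      Real.exp (-a) * ((1 - Real.exp (-τ)) ^ n -
        ((1 - Real.exp (-(1 + b) * τ)) / (1 + b)) ^ n) := by
  -- After the geometric sum, the terms in `exp(-a - b * p * τ)` cancel except for the one carrying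
  -- `(1 + b)^{-n}`; both remaining pieces are binomial in `p`.
  have hterm (p : ℕ) : (n.choose p : ℝ) * (-1) ^ p * Real.exp (-(p : ℝ) * τ) *
        ((∑ l ∈ Finset.range n, b * Real.exp (-a - b * (p : ℝ) * τ) / (1 + b) ^ (l + 1))
          + Real.exp (-a) - Real.exp (-a - b * (p : ℝ) * τ)) =
      Real.exp (-a) * ((n.choose p : ℝ) * (-1) ^ p * Real.exp (-(p : ℝ) * τ)) -
        Real.exp (-a) * ((1 + b) ^ n)⁻¹ *
          ((n.choose p : ℝ) * (-1) ^ p * Real.exp (-(p : ℝ) * ((1 + b) * τ))) := by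
    have e1 : Real.exp (-a - b * (p : ℝ) * τ) = Real.exp (-a) * Real.exp (-(b * p * τ)) := by
      rw [← Real.exp_add]; ring_nf
    have e2 : Real.exp (-(p : ℝ) * ((1 + b) * τ)) =
        Real.exp (-(p : ℝ) * τ) * Real.exp (-(b * p * τ)) := by
      rw [← Real.exp_add]; ring_nf
    rw [sum_range_div_one_add_pow hb, e1, e2]
    ring
  rw [Finset.sum_congr rfl fun p _ => hterm p, Finset.sum_sub_distrib, ← Finset.mul_sum,
    ← Finset.mul_sum, sum_choose_mul_neg_one_pow_mul_exp, sum_choose_mul_neg_one_pow_mul_exp,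
    div_pow, neg_mul]
  ring

theorem theorem1 {Ω : Type*} [MeasurableSpace Ω] (P : Measure Ω) [IsProbabilityMeasure P]
    (M : ℕ) (h : Fin (M + 1) → Ω → ℂ) (hfading : IsRayleighFading P h)
    (P₀ Pbar τ R₀ ε₀ : ℝ) (hP₀ : 0 < P₀) (hPbar : 0 < Pbar) (hτ : 0 < τ) (hR₀ : 0 < R₀)
    (hε₀ : ε₀ = (2 : ℝ) ^ R₀ - 1) :
    outageProbabilityU0 P h P₀ Pbar τ R₀ =
      (∑ n ∈ Finset.Icc 1 M,
        ((M.factorial : ℝ) / ((n.factorial : ℝ) * ((M - n).factorial : ℝ))) *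
          Real.exp (-((M : ℝ) - (n : ℝ)) * τ) * (1 - Real.exp (-τ)) ^ n *
          ∑ p ∈ Finset.range (n + 1),
            ((n.choose p : ℝ) * (-1) ^ p * Real.exp (-(p : ℝ) * τ) / (1 - Real.exp (-τ)) ^ n) *
              ((∑ l ∈ Finset.range n,
                  ε₀ * P₀⁻¹ * Pbar * Real.exp (-ε₀ * P₀⁻¹ * (1 + Pbar * (p : ℝ) * τ)) /
                    (1 + ε₀ * P₀⁻¹ * Pbar) ^ (l + 1))
                + Real.exp (-ε₀ * P₀⁻¹)
                - Real.exp (-ε₀ * P₀⁻¹ * (1 + Pbar * (p : ℝ) * τ))))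
      + (1 - Real.exp (-ε₀ * P₀⁻¹)) := by
  have hε : 0 < ε₀ := by
    rw [hε₀, sub_pos]
    exact Real.one_lt_rpow one_lt_two hR₀
  rw [outageProbabilityU0_eq_one_sub P hfading hP₀ hPbar hτ hε.le hε₀]
  set b := ε₀ * P₀⁻¹ * Pbar with hb
  have hb0 : 0 < b := by positivity
  set K := (1 - Real.exp (-(1 + b) * τ)) / (1 + b) with hK
  have hq : 1 - Real.exp (-τ) ≠ 0 :=
    (sub_pos.2 (by simpa using hτ)).ne'
  have hterm (n : ℕ) (hn : n ≤ M) :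
      ((M.factorial : ℝ) / ((n.factorial : ℝ) * ((M - n).factorial : ℝ))) *
          Real.exp (-((M : ℝ) - (n : ℝ)) * τ) * (1 - Real.exp (-τ)) ^ n *
          ∑ p ∈ Finset.range (n + 1),
            ((n.choose p : ℝ) * (-1) ^ p * Real.exp (-(p : ℝ) * τ) / (1 - Real.exp (-τ)) ^ n) *
              ((∑ l ∈ Finset.range n,
                  b * Real.exp (-ε₀ * P₀⁻¹ * (1 + Pbar * (p : ℝ) * τ)) / (1 + b) ^ (l + 1))
                + Real.exp (-ε₀ * P₀⁻¹)
                - Real.exp (-ε₀ * P₀⁻¹ * (1 + Pbar * (p : ℝ) * τ))) =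
        Real.exp (-ε₀ * P₀⁻¹) *
          ((1 - Real.exp (-τ)) ^ n * Real.exp (-τ) ^ (M - n) * (M.choose n : ℝ)) -
        Real.exp (-ε₀ * P₀⁻¹) * (K ^ n * Real.exp (-τ) ^ (M - n) * (M.choose n : ℝ)) := by
    have hexp (p : ℕ) : -ε₀ * P₀⁻¹ * (1 + Pbar * (p : ℝ) * τ) =
        -(ε₀ * P₀⁻¹) - b * (p : ℝ) * τ := by rw [hb]; ring
    simp_rw [hexp, div_mul_eq_mul_div _ ((1 - Real.exp (-τ)) ^ n)]
    rw [← Finset.sum_div, neg_mul ε₀, alternating_sum_eq hb0, ← Nat.cast_choose ℝ hn,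
      ← Real.exp_nat_mul, Nat.cast_sub hn, mul_assoc, mul_div_cancel₀ _ (pow_ne_zero n hq), ← hK]
    ring_nf
  rw [Finset.sum_congr rfl fun n hn => hterm n (Finset.mem_Icc.1 hn).2]
  -- The `n = 0` term vanishes because both `n`-th powers are `1`; including it completes the two
  -- binomial expansions.
  rw [Finset.sum_subset (s₂ := Finset.range (M + 1))
    (fun n hn => Finset.mem_range_succ_iff.2 (Finset.mem_Icc.1 hn).2), Finset.sum_sub_distrib,
    ← Finset.mul_sum, ← Finset.mul_sum, ← add_pow, ← add_pow]
  · simp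
  · intro n hn hn'
    obtain rfl : n = 0 := by
      simp only [Finset.mem_range, Finset.mem_Icc] at hn hn'
      omega
    simp
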